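/- Let $n\ge 2$ be an integer and $\epsilon,\eta>0$. For $A\ge 1$ let $\mathcal C_{n,\epsilon,\eta}(A)$ be the class of continuously differentiable functions $f:[0,1]^n\to\mathbb R$ such that 1. $f>0$ on $[0,1]^n$ and $|\partial_i\log f(x)|\le A$ for all $x\in[0,1]^n$ and $i=1,\dots,n$; 2. $f(x+t(y-x))\ge \epsilon\min\{f(x),f(y)\}$ for all $x,y\in[0,1]^n$ and $t\in[0,1]$; 3. $\eta\,\|f\|_\infty\le\int_{[0,1]^n}f(x)\,dx$. For an integer $N\ge 2$ put $B_N=\{1,\dots,N\}^n$ and $F_N(\mathbf k)=f\big((k_1-\tfrac12)/N,\dots,(k_n-\tfrac12)/N\big)$ for $\mathbf k\in B_N$, and write $|\mathbf k-\mathbf l|=\sum_i|k_i-l_i|$. The associated Metropolis chain on $B_N$, with simple random walk proposal, has kernel $$M(\mathbf k,\mathbf l)=\begin{cases}\frac1{2n}\min\{1,F_N(\mathbf l)/F_N(\mathbf k)\} & \text{if } |\mathbf k-\mathbf l|=1,\\[2pt] \frac{\#\{i:\,k_i\in\{1,N\}\}}{2n}+\displaystyle\sum_{\mathbf m:\,|\mathbf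 k-\mathbf m|=1,\ F_N(\mathbf m)<F_N(\mathbf k)}\frac1{2n}\Big(1-\frac{F_N(\mathbf m)}{F_N(\mathbf k)}\Big) & \text{if } \mathbf k=\mathbf l,\\ 0&\text{otherwise.}\end{cases}$$ It is reversible with respect to the probability measure proportional to $F_N$, so its eigenvalues are real; let $1=\beta_0\ge\beta_1\ge\cdots$ be these eigenvalues, repeated according to multiplicity. Its spectral gap is $\lambda=1-\beta_1$. Then there is a constant $c=c_{n,\epsilon,\eta}>0$, depending only on $n,\epsilon,\eta$, such that for every real $A\ge 1$, every integer $N\ge\max\{A,2\}$ and every $f\in\mathcal C_{n,\epsilon,\eta}(A)$, $$\lambda\ \ge\ \frac{c_{n,\epsilon,\eta}}{N^2}.$$ -/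

import Mathlib

open scoped BigOperators

noncomputable section

namespace MetropolisFlat

/-- The discrete box `{1, …, N}ⁿ`. Coordinates are stored from `0`: the entry `j : Fin N` stands
for the integer `j + 1`. -/
abbrev Box (n N : ℕ) : Type := Fin n → Fin N

/-- Two box points are neighbours when their `ℓ¹` distance is `1`. -/
abbrev Adj {n N : ℕ} (k l : Box n N) : Prop :=
  ∑ i, |((k i : ℕ) : ℤ) - ((l i : ℕ) : ℤ)| = 1

/-- Holding probability `Q(k,k)` of the proposal chain, the simple random walk on the box: each of
the `2n` directions is chosen with probability `1/(2n)` and steps that would leave the box (one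
for each coordinate equal to `1`, one for each coordinate equal to `N`) are suppressed. -/
def proposalHold {n N : ℕ} (k : Box n N) : ℝ :=
  (((Finset.univ.filter fun i => (k i : ℕ) + 1 = 1).card : ℝ)
    + ((Finset.univ.filter fun i => (k i : ℕ) + 1 = N).card : ℝ)) / (2 * n)

/-- The kernel `M` of the Metropolis chain on `{1, …, N}ⁿ` with (unnormalised) target `F` and
simple random walk proposal. -/
def metropolis {n N : ℕ} (F : Box n N → ℝ) : Matrix (Box n N) (Box n N) ℝ :=
  Matrix.of fun k l =>
    if Adj k l then 1 / (2 * (n : ℝ)) * min 1 (F l / F k)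
    else if k = l then
      proposalHold k
        + ∑ m ∈ Finset.univ.filter (fun m => Adj k m ∧ F m < F k),
            1 / (2 * (n : ℝ)) * (1 - F m / F k)
    else 0

/-- The eigenvalues of a real matrix, repeated according to algebraic multiplicity, in
decreasing order. -/
def eigenvalueList {ι : Type*} [Fintype ι] [DecidableEq ι] (M : Matrix ι ι ℝ) : List ℝ :=
  M.charpoly.roots.sort (fun a b => b ≤ a)

/-- The spectral gap `λ = 1 - β₁`, where `β₀ ≥ β₁ ≥ …` are the eigenvalues repeated according to
multiplicity. (If there were no second eigenvalue, this would be `0`.) -/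
def spectralGap {ι : Type*} [Fintype ι] [DecidableEq ι] (M : Matrix ι ι ℝ) : ℝ :=
  1 - (eigenvalueList M).getD 1 1

/-- The closed unit cube `[0,1]ⁿ`. -/
abbrev unitCube (n : ℕ) : Set (Fin n → ℝ) := Set.Icc 0 1

/-- The discretisation `F_N(k) = f((k₁ - 1/2)/N, …, (kₙ - 1/2)/N)` on `{1, …, N}ⁿ`. -/
def discretize {n : ℕ} (N : ℕ) (f : (Fin n → ℝ) → ℝ) : Box n N → ℝ :=
  fun k => f fun i => ((((k i : ℕ) + 1 : ℕ) : ℝ) - 1 / 2) / N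

/-- The class `𝒞_{n,ε,η}(A)` of functions on the cube `[0,1]ⁿ`; only the values of `f` on the
cube matter, and derivatives at boundary points are taken within the cube. -/
structure FlatClass (n : ℕ) (ε η A : ℝ) (f : (Fin n → ℝ) → ℝ) : Prop where
  contDiffOn : ContDiffOn ℝ 1 f (unitCube n)
  pos : ∀ x ∈ unitCube n, 0 < f x
  partial_log_le : ∀ x ∈ unitCube n, ∀ i : Fin n,
    |fderivWithin ℝ (fun y => Real.log (f y)) (unitCube n) x (Pi.single i 1)| ≤ A
  segment : ∀ x ∈ unitCube n, ∀ y ∈ unitCube n, ∀ t ∈ Set.Icc (0 : ℝ) 1,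
    ε * min (f x) (f y) ≤ f (x + t • (y - x))
  sup_le_integral :
    η * sSup ((fun x => |f x|) '' unitCube n) ≤ ∫ x in unitCube n, f x

end MetropolisFlat

end

/-! The proof is a canonical path argument with weights. Write Z for the total mass of F =
`discretize N f`, and join every pair x, y of box points by the discretised straight segment, moving
one coordinate at a time; this takes nN steps, each an edge or trivial. For φ of mean zero the
double sum of F(x)F(y)(φ(x) - φ(y))² is 2Z times the sum of Fφ², and Cauchy–Schwarz along the path
bounds it by energies of edges.

Three facts control the congestion. Factor F(x)F(y) as max times min: the max is at most ‖f‖∞, while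
the segment condition gives F ≥ κ min(F(x), F(y)) on the whole path (`FlatClass.le_pathPoint`). At a
fixed stage, a given point lies on at most (2N)ⁿ paths (`card_linePoint_fiber_le`). Finally ‖f‖∞ Nⁿ
is at most a constant times Z (`FlatClass.integral_le_sum` and the condition with η), which cancels
the Nⁿ. What remains is (nN)²: one factor nN from Cauchy–Schwarz, one from the number of stages.

The slope A enters only through A ≤ N: at distance of order 1/N, f changes by a factor depending on
n alone, so rounding is harmless. -/

namespace MetropolisFlat

open Matrix

/-! ### Spectral gap, Poincaré inequality and Dirichlet form -/

/-- A Poincaré inequality on functions of mean zero bounds the spectral gap of a reversible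
matrix from below. -/
theorem le_spectralGap_of_poincare {ι : Type*} [Fintype ι] [DecidableEq ι] (M : Matrix ι ι ℝ)
    (w : ι → ℝ) (hw : ∀ i, 0 < w i) (hrev : ∀ i j, w i * M i j = w j * M j i)
    (hcard : 1 < Fintype.card ι) (g : ℝ)
    (hg : ∀ φ : ι → ℝ, ∑ i, w i * φ i = 0 →
      g * ∑ i, w i * φ i ^ 2 ≤ ∑ i, w i * φ i * (φ i - ∑ j, M i j * φ j)) :
    g ≤ spectralGap M := by
  have hr : ∀ i, 0 < √(w i) := fun i => Real.sqrt_pos.2 (hw i)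
  have hrr : ∀ i, √(w i) * √(w i) = w i := fun i => Real.mul_self_sqrt (hw i).le
  set D : Matrix ι ι ℝ := diagonal fun i => √(w i) with hD
  set D' : Matrix ι ι ℝ := diagonal fun i => (√(w i))⁻¹ with hD'
  have hDD : D' * D = 1 := by
    rw [hD, hD', diagonal_mul_diagonal, ← diagonal_one]
    congr 1; funext i
    exact inv_mul_cancel₀ (hr i).ne'
  -- Reversibility makes this conjugate of M symmetric, with the same characteristic polynomial.
  set S : Matrix ι ι ℝ := D * M * D' with hS
  have hSap : ∀ i j, S i j = √(w i) * M i j * (√(w j))⁻¹ := fun i j => by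
    rw [hS, hD', mul_diagonal, hD, diagonal_mul]
  have hSM : S.charpoly = M.charpoly := by
    rw [hS, charpoly_mul_comm, ← mul_assoc, hDD, one_mul]
  have hH : S.IsHermitian := by
    ext i j
    rw [conjTranspose_apply, star_trivial, hSap, hSap]
    have h1 := (hr i).ne'
    have h2 := (hr j).ne'
    field_simp
    have := hrev i j
    rw [← hrr i, ← hrr j] at this
    linear_combination -this
  have hlist : eigenvalueList M = List.ofFn hH.eigenvalues₀ := by
    have h := hH.sort_roots_charpoly_eq_eigenvalues₀
    rw [hSM] at h
    simpa [eigenvalueList] using h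
  set μ := hH.eigenvalues₀ with hμ
  have hgap : spectralGap M = 1 - μ ⟨1, hcard⟩ := by
    rw [spectralGap, hlist, List.getD_eq_getElem _ _ (by simpa using hcard)]
    simp
  rw [hgap]
  set e := (Fintype.equivOfCardEq (Fintype.card_fin (Fintype.card ι))) with he
  set i₀ : ι := e ⟨0, by omega⟩ with hi₀
  set i₁ : ι := e ⟨1, hcard⟩ with hi₁
  have hne : i₀ ≠ i₁ := by
    intro h
    have := e.injective h
    simp at this
  have hm₀ : μ ⟨1, hcard⟩ ≤ hH.eigenvalues i₀ := by
    have : hH.eigenvalues i₀ = μ ⟨0, by omega⟩ := by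
      simp [IsHermitian.eigenvalues, hi₀, he, hμ]
    rw [this]
    exact hH.eigenvalues₀_antitone (by simp)
  have hm₁ : μ ⟨1, hcard⟩ = hH.eigenvalues i₁ := by
    simp [IsHermitian.eigenvalues, hi₁, he, hμ]
  set m := μ ⟨1, hcard⟩
  set u : ι → ℝ := (hH.eigenvectorBasis i₀).ofLp with hu
  set v : ι → ℝ := (hH.eigenvectorBasis i₁).ofLp with hv
  have hSu : S *ᵥ u = hH.eigenvalues i₀ • u := hH.mulVec_eigenvectorBasis i₀
  have hSv : S *ᵥ v = hH.eigenvalues i₁ • v := hH.mulVec_eigenvectorBasis i₁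
  have horth := orthonormal_iff_ite.1 hH.eigenvectorBasis.orthonormal
  have huu : u ⬝ᵥ u = 1 := by
    have := horth i₀ i₀
    rwa [EuclideanSpace.inner_eq_star_dotProduct, star_trivial, if_pos rfl] at this
  have hvv : v ⬝ᵥ v = 1 := by
    have := horth i₁ i₁
    rwa [EuclideanSpace.inner_eq_star_dotProduct, star_trivial, if_pos rfl] at this
  have huv : u ⬝ᵥ v = 0 := by
    have := horth i₁ i₀
    rwa [EuclideanSpace.inner_eq_star_dotProduct, star_trivial, if_neg hne.symm] at this
  have hvu : v ⬝ᵥ u = 0 := by rw [dotProduct_comm, huv]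
  -- The span of the top two eigenvectors is two-dimensional, so it contains a nonzero vector
  -- orthogonal to √w. Its Rayleigh quotient is at least β₁, and dividing it by √w gives a mean-zero
  -- test function. That constants are eigenfunctions is never needed.
  obtain ⟨a, b, hab, hmean⟩ : ∃ a b : ℝ, 0 < a ^ 2 + b ^ 2 ∧
      a * ∑ i, √(w i) * u i + b * ∑ i, √(w i) * v i = 0 := by
    by_cases h : ∑ i, √(w i) * u i = 0
    · exact ⟨1, 0, by norm_num, by simp [h]⟩
    · refine ⟨-∑ i, √(w i) * v i, ∑ i, √(w i) * u i, ?_, by ring⟩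
      have := sq_pos_of_ne_zero h
      positivity
  set z : ι → ℝ := a • u + b • v with hz
  have hzz : z ⬝ᵥ z = a ^ 2 + b ^ 2 := by
    simp only [hz, add_dotProduct, dotProduct_add, smul_dotProduct, dotProduct_smul, huu, hvv,
      huv, hvu, smul_eq_mul]
    ring
  have hzS : z ⬝ᵥ (S *ᵥ z) = a ^ 2 * hH.eigenvalues i₀ + b ^ 2 * hH.eigenvalues i₁ := by
    simp only [hz, mulVec_add, mulVec_smul, hSu, hSv, add_dotProduct, dotProduct_add,
      smul_dotProduct, dotProduct_smul, huu, hvv, huv, hvu, smul_eq_mul]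
    ring
  have key := hg (fun i => (√(w i))⁻¹ * z i) (by
    rw [← hmean, Finset.mul_sum, Finset.mul_sum, ← Finset.sum_add_distrib]
    refine Finset.sum_congr rfl fun i _ => ?_
    have h1 := (hr i).ne'
    rw [← hrr i]
    simp only [hz, Pi.add_apply, Pi.smul_apply, smul_eq_mul]
    rw [hrr i]
    field_simp
    rw [sq, hrr])
  have e1 : ∑ i, w i * ((√(w i))⁻¹ * z i) ^ 2 = z ⬝ᵥ z := by
    refine Finset.sum_congr rfl fun i _ => ?_
    have h1 := (hr i).ne'
    field_simp
    rw [Real.sq_sqrt (hw i).le]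
  have e2 : ∑ i, w i * ((√(w i))⁻¹ * z i) * ((√(w i))⁻¹ * z i - ∑ j, M i j * ((√(w j))⁻¹ * z j))
      = z ⬝ᵥ z - z ⬝ᵥ (S *ᵥ z) := by
    rw [dotProduct, dotProduct, ← Finset.sum_sub_distrib]
    refine Finset.sum_congr rfl fun i _ => ?_
    have h3 : (S *ᵥ z) i = √(w i) * ∑ j, M i j * ((√(w j))⁻¹ * z j) := by
      rw [mulVec, dotProduct, Finset.mul_sum]
      exact Finset.sum_congr rfl fun j _ => by rw [hSap]; ring
    rw [h3]
    have h1 := (hr i).ne'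
    have h4 : w i * (√(w i))⁻¹ = √(w i) := by
      field_simp; rw [sq, hrr]
    have h5 : √(w i) * (√(w i))⁻¹ = 1 := mul_inv_cancel₀ h1
    rw [← mul_assoc, h4]
    linear_combination z i * z i * h5
  rw [e1, e2, hzz, hzS, ← hm₁] at key
  have : g * (a ^ 2 + b ^ 2) ≤ (1 - m) * (a ^ 2 + b ^ 2) := by
    nlinarith [mul_le_mul_of_nonneg_left hm₀ (sq_nonneg a)]
  exact le_of_mul_le_mul_right this hab

/-- The Dirichlet form of a reversible substochastic matrix. -/
theorem dirichlet_le {ι : Type*} [Fintype ι] (M : Matrix ι ι ℝ) (w : ι → ℝ) (hw : ∀ i, 0 < w i)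
    (hrev : ∀ i j, w i * M i j = w j * M j i) (hrow : ∀ i, ∑ j, M i j ≤ 1) (φ : ι → ℝ) :
    1 / 2 * ∑ i, ∑ j, w i * M i j * (φ i - φ j) ^ 2 ≤
      ∑ i, w i * φ i * (φ i - ∑ j, M i j * φ j) := by
  have h1 : ∑ i, ∑ j, w i * M i j * φ j ^ 2 = ∑ i, ∑ j, w i * M i j * φ i ^ 2 := by
    rw [Finset.sum_comm]
    exact Finset.sum_congr rfl fun i _ => Finset.sum_congr rfl fun j _ => by rw [hrev]
  have h2 : ∑ i, ∑ j, w i * M i j * φ i ^ 2 ≤ ∑ i, w i * φ i ^ 2 := by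
    refine Finset.sum_le_sum fun i _ => ?_
    rw [← Finset.sum_mul, ← Finset.mul_sum]
    have := mul_le_mul_of_nonneg_left (hrow i) (mul_nonneg (hw i).le (sq_nonneg (φ i)))
    linarith
  have h3 : ∑ i, ∑ j, w i * M i j * (φ i - φ j) ^ 2 =
      ∑ i, ∑ j, w i * M i j * φ i ^ 2 + ∑ i, ∑ j, w i * M i j * φ j ^ 2
        - 2 * ∑ i, w i * φ i * ∑ j, M i j * φ j := by
    simp only [Finset.mul_sum, ← Finset.sum_add_distrib, ← Finset.sum_sub_distrib]
    exact Finset.sum_congr rfl fun i _ => Finset.sum_congr rfl fun j _ => by ring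
  have h4 : ∑ i, w i * φ i * (φ i - ∑ j, M i j * φ j) =
      ∑ i, w i * φ i ^ 2 - ∑ i, w i * φ i * ∑ j, M i j * φ j := by
    rw [← Finset.sum_sub_distrib]
    exact Finset.sum_congr rfl fun i _ => by ring
  rw [h3, h4, h1]
  linarith

/-! ### The Metropolis kernel: neighbours, reversibility, row sums -/

theorem Adj.symm {n N : ℕ} {k l : Box n N} (h : Adj k l) : Adj l k := by
  unfold Adj at *
  rw [← h]
  exact Finset.sum_congr rfl fun i _ => abs_sub_comm _ _

theorem Adj.ne {n N : ℕ} {k l : Box n N} (h : Adj k l) : k ≠ l := by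
  rintro rfl
  simp [Adj] at h

/-- Neighbours differ in exactly one coordinate, by one. -/
theorem Adj.exists_update {n N : ℕ} {k l : Box n N} (h : Adj k l) :
    ∃ i, |((k i : ℕ) : ℤ) - ((l i : ℕ) : ℤ)| = 1 ∧ ∀ j, j ≠ i → k j = l j := by
  obtain ⟨i, hi⟩ : ∃ i, |((k i : ℕ) : ℤ) - ((l i : ℕ) : ℤ)| ≠ 0 := by
    by_contra! hc
    simp only [Adj, hc] at h
    simp at h
  have hpos : 1 ≤ |((k i : ℕ) : ℤ) - ((l i : ℕ) : ℤ)| :=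
    lt_of_le_of_ne (abs_nonneg _) (Ne.symm hi)
  have hs := Finset.add_sum_erase Finset.univ
    (fun i => |((k i : ℕ) : ℤ) - ((l i : ℕ) : ℤ)|) (Finset.mem_univ i)
  have hnn : ∀ j ∈ Finset.univ.erase i, 0 ≤ |((k j : ℕ) : ℤ) - ((l j : ℕ) : ℤ)| :=
    fun j _ => abs_nonneg _
  have hn := Finset.sum_nonneg hnn
  unfold Adj at h
  simp only [h] at hs
  refine ⟨i, by linarith, fun j hj => ?_⟩
  have h0 := (Finset.sum_eq_zero_iff_of_nonneg hnn).1 (by linarith) j (by simp [hj])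
  rw [abs_eq_zero, sub_eq_zero] at h0
  exact Fin.ext (by exact_mod_cast h0)

/-- Neighbours and suppressed directions together number at most `2n`. -/
theorem card_adj_add_boundary_le {n N : ℕ} (k : Box n N) :
    (Finset.univ.filter fun l => Adj k l).card
      + ((Finset.univ.filter fun i => (k i : ℕ) + 1 = 1).card
        + (Finset.univ.filter fun i => (k i : ℕ) + 1 = N).card) ≤ 2 * n := by
  let z : Box n N → Fin n → ℤ := fun l i => ((l i : ℕ) : ℤ)
  have hz : Function.Injective z := fun a b hab => by
    funext i
    have := congrFun hab i
    simp only [z] at this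
    exact Fin.ext (by exact_mod_cast this)
  -- In ℤⁿ the 2n points k ± eᵢ always exist. A step down is available only if the coordinate is not
  -- 1, a step up only if it is not N.
  have hsub : (Finset.univ.filter fun l => Adj k l).image z ⊆
      ((Finset.univ.filter fun i => ¬ (k i : ℕ) + 1 = 1).image
        fun i => Function.update (z k) i (z k i - 1)) ∪
      ((Finset.univ.filter fun i => ¬ (k i : ℕ) + 1 = N).image
        fun i => Function.update (z k) i (z k i + 1)) := by
    intro p hp
    obtain ⟨l, hl, rfl⟩ := Finset.mem_image.1 hp
    obtain ⟨i, hi, hj⟩ := ((Finset.mem_filter.1 hl).2).exists_update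
    have hup : z l = Function.update (z k) i (z l i) := by
      funext j
      by_cases hji : j = i
      · subst hji; simp
      · simp [Function.update_of_ne hji, z, hj j hji]
    have hlN := (l i).isLt
    rw [Finset.mem_union]
    rcases (abs_eq (by norm_num)).1 hi with h | h
    · left
      refine Finset.mem_image.2 ⟨i, ?_, ?_⟩
      · simp only [Finset.mem_filter, Finset.mem_univ, true_and]; omega
      · rw [hup]; congr 1; simp only [z]; omega
    · right
      refine Finset.mem_image.2 ⟨i, ?_, ?_⟩
      · simp only [Finset.mem_filter, Finset.mem_univ, true_and]; omega
      · rw [hup]; congr 1; simp only [z]; omega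
  have h1 := Finset.card_le_card hsub
  rw [Finset.card_image_of_injective _ hz] at h1
  have h2 := h1.trans (Finset.card_union_le _ _)
  have h3 := h2.trans (Nat.add_le_add Finset.card_image_le Finset.card_image_le)
  have h4 := Finset.card_filter_add_card_filter_not (s := (Finset.univ : Finset (Fin n)))
    fun i => (k i : ℕ) + 1 = 1
  have h5 := Finset.card_filter_add_card_filter_not (s := (Finset.univ : Finset (Fin n)))
    fun i => (k i : ℕ) + 1 = N
  simp only [Finset.card_univ, Fintype.card_fin] at h4 h5
  omega

/-- Unnormalised energy of an edge of the box. -/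
def edgeEnergy {n N : ℕ} (F φ : Box n N → ℝ) (k l : Box n N) : ℝ :=
  if Adj k l then min (F k) (F l) * (φ k - φ l) ^ 2 else 0

theorem mul_metropolis_of_adj {n N : ℕ} {F : Box n N → ℝ} (hF : ∀ k, 0 < F k) {k l : Box n N}
    (h : Adj k l) : F k * metropolis F k l = 1 / (2 * (n : ℝ)) * min (F k) (F l) := by
  rw [metropolis, of_apply, if_pos h, mul_left_comm, mul_min_of_nonneg _ _ (hF k).le, mul_one,
    mul_div_cancel₀ _ (hF k).ne']

theorem metropolis_of_not_adj_of_ne {n N : ℕ} {F : Box n N → ℝ} {k l : Box n N}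
    (h : ¬ Adj k l) (h' : k ≠ l) : metropolis F k l = 0 := by
  rw [metropolis, of_apply, if_neg h, if_neg h']

theorem metropolis_reversible {n N : ℕ} {F : Box n N → ℝ} (hF : ∀ k, 0 < F k) (k l : Box n N) :
    F k * metropolis F k l = F l * metropolis F l k := by
  by_cases h : Adj k l
  · rw [mul_metropolis_of_adj hF h, mul_metropolis_of_adj hF h.symm, min_comm]
  · by_cases h' : k = l
    · rw [h']
    · rw [metropolis_of_not_adj_of_ne h h',
        metropolis_of_not_adj_of_ne (fun hc => h hc.symm) (Ne.symm h')]
      simp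

/-- Since min(1, r) + max(0, 1 - r) = 1, accepted and rejected moves to each neighbour add up to
1/(2n). The count of neighbours and suppressed directions does the rest; the inequality suffices for
`dirichlet_le`. -/
theorem metropolis_row_le {n N : ℕ} (hn : 0 < n) {F : Box n N → ℝ} (hF : ∀ k, 0 < F k)
    (k : Box n N) : ∑ l, metropolis F k l ≤ 1 := by
  have hnR : (0 : ℝ) < 2 * n := by positivity
  have hdiag : metropolis F k k = proposalHold k
      + ∑ m ∈ Finset.univ.filter (fun m => Adj k m ∧ F m < F k),
            1 / (2 * (n : ℝ)) * (1 - F m / F k) := by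
    rw [metropolis, of_apply, if_neg (fun h : Adj k k => h.ne rfl), if_pos rfl]
  have hoff : ∀ l, metropolis F k l = (if k = l then metropolis F k k else 0) +
      (if Adj k l then 1 / (2 * (n : ℝ)) * min 1 (F l / F k) else 0) := by
    intro l
    by_cases h : Adj k l
    · rw [if_neg h.ne, if_pos h, zero_add, metropolis, of_apply, if_pos h]
    · by_cases h' : k = l
      · subst h'; rw [if_pos rfl, if_neg h, add_zero]
      · rw [if_neg h, if_neg h', metropolis_of_not_adj_of_ne h h', add_zero]
  rw [Finset.sum_congr rfl fun l _ => hoff l, Finset.sum_add_distrib, Finset.sum_ite_eq,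
    if_pos (Finset.mem_univ k), hdiag]
  have hsum : ∑ m ∈ Finset.univ.filter (fun m => Adj k m ∧ F m < F k),
        1 / (2 * (n : ℝ)) * (1 - F m / F k)
      + ∑ l, (if Adj k l then 1 / (2 * (n : ℝ)) * min 1 (F l / F k) else 0) =
      (Finset.univ.filter fun l => Adj k l).card / (2 * (n : ℝ)) := by
    rw [Finset.sum_filter, ← Finset.sum_add_distrib, div_eq_mul_one_div
      ((Finset.univ.filter fun l => Adj k l).card : ℝ), ← nsmul_eq_mul,
      ← Finset.sum_const, Finset.sum_filter]
    refine Finset.sum_congr rfl fun l _ => ?_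
    by_cases h : Adj k l
    · by_cases h' : F l < F k
      · rw [if_pos ⟨h, h'⟩, if_pos h, if_pos h, min_eq_right ((div_le_one (hF k)).2 h'.le)]
        ring
      · rw [if_neg (fun hc => h' hc.2), if_pos h, if_pos h,
          min_eq_left ((one_le_div (hF k)).2 (not_lt.1 h'))]
        ring
    · rw [if_neg (fun hc => h hc.1), if_neg h, if_neg h, add_zero]
  rw [add_assoc, hsum, proposalHold, ← add_div, div_le_one hnR]
  have := card_adj_add_boundary_le k
  have h' : (((Finset.univ.filter fun l => Adj k l).card
      + ((Finset.univ.filter fun i => (k i : ℕ) + 1 = 1).card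
        + (Finset.univ.filter fun i => (k i : ℕ) + 1 = N).card) : ℕ) : ℝ) ≤ ((2 * n : ℕ) : ℝ) := by
    exact_mod_cast this
  rw [Nat.cast_add, Nat.cast_add, Nat.cast_mul, Nat.cast_two] at h'
  linarith

/-- The Dirichlet form of the Metropolis chain in terms of edge energies. -/
theorem edgeEnergy_le_dirichlet {n N : ℕ} (hn : 0 < n) {F : Box n N → ℝ} (hF : ∀ k, 0 < F k)
    (φ : Box n N → ℝ) :
    1 / (4 * (n : ℝ)) * ∑ k, ∑ l, edgeEnergy F φ k l ≤
      ∑ k, F k * φ k * (φ k - ∑ l, metropolis F k l * φ l) := by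
  refine le_trans (le_of_eq ?_) (dirichlet_le (metropolis F) F hF (metropolis_reversible hF)
    (metropolis_row_le hn hF) φ)
  simp only [Finset.mul_sum]
  refine Finset.sum_congr rfl fun k _ => Finset.sum_congr rfl fun l _ => ?_
  by_cases h : Adj k l
  · rw [mul_metropolis_of_adj hF h, edgeEnergy, if_pos h]
    ring
  · rw [edgeEnergy, if_neg h]
    by_cases h' : k = l
    · subst h'; simp
    · rw [metropolis_of_not_adj_of_ne h h']; simp

/-! ### Lattice paths along segments -/

/-- The discretised segment from `x` to `y` at coordinatewise times `t / N`. -/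
def linePoint {n N : ℕ} (t : Fin n → ℕ) (x y : Box n N) : Box n N := fun i =>
  ⟨((x i : ℕ) * (N - min (t i) N) + (y i : ℕ) * min (t i) N) / N, by
    have hx := (x i).isLt
    have hy := (y i).isLt
    have hN : 0 < N := by omega
    rw [Nat.div_lt_iff_lt_mul hN]
    obtain ⟨r, hr⟩ := Nat.exists_eq_add_of_le (min_le_right (t i) N)
    have h1 : N - min (t i) N = r := by omega
    rw [h1]
    have h2 : (x i : ℕ) * r ≤ (N - 1) * r := Nat.mul_le_mul_right _ (by omega)
    have h3 : (y i : ℕ) * min (t i) N ≤ (N - 1) * min (t i) N := Nat.mul_le_mul_right _ (by omega)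
    calc _ ≤ (N - 1) * r + (N - 1) * min (t i) N := Nat.add_le_add h2 h3
      _ = (N - 1) * N := by rw [← mul_add]; congr 1; omega
      _ < N * N := Nat.mul_lt_mul_of_pos_right (by omega) hN⟩

/-- The lattice path between `x` and `y`: at stage `(s, j)` the first `j` coordinates have already
advanced from time `s` to time `s + 1`. -/
def pathPoint {n N : ℕ} (s j : ℕ) (x y : Box n N) : Box n N :=
  linePoint (fun i => if (i : ℕ) < j then s + 1 else s) x y

theorem linePoint_val {n N : ℕ} {t : Fin n → ℕ} (ht : ∀ i, t i ≤ N) (x y : Box n N) (i : Fin n) :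
    (linePoint t x y i : ℕ) = ((x i : ℕ) * (N - t i) + (y i : ℕ) * t i) / N := by
  simp [linePoint, min_eq_left (ht i)]

theorem pathPoint_zero_zero {n N : ℕ} (x y : Box n N) : pathPoint 0 0 x y = x := by
  funext i
  refine Fin.ext ?_
  have hN : 0 < N := by have := (x i).isLt; omega
  rw [pathPoint, linePoint_val (by simp)]
  simp [hN]

theorem pathPoint_end {n N : ℕ} (x y : Box n N) : pathPoint N 0 x y = y := by
  funext i
  refine Fin.ext ?_
  have hN : 0 < N := by have := (x i).isLt; omega
  rw [pathPoint, linePoint_val (by simp)]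
  simp [hN]

theorem pathPoint_last {n N : ℕ} (s : ℕ) (x y : Box n N) :
    pathPoint s n x y = pathPoint (s + 1) 0 x y := by
  simp [pathPoint]

/-- One time step changes the numerator by v - u, less than N in absolute value, so the floor moves
by at most one. -/
theorem div_line_succ {N u v s : ℕ} (hu : u < N) (hv : v < N) (hs : s < N) :
    |(((u * (N - s) + v * s) / N : ℕ) : ℤ) - ((u * (N - (s + 1)) + v * (s + 1)) / N : ℕ)| ≤ 1 := by
  have hN : 0 < N := by omega
  obtain ⟨r, rfl⟩ := Nat.exists_eq_add_of_lt hs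
  have h1 : s + r + 1 - s = r + 1 := by omega
  have h2 : s + r + 1 - (s + 1) = r := by omega
  rw [h1, h2]
  set M := s + r + 1
  have e1 := Nat.div_add_mod (u * (r + 1) + v * s) M
  have e2 := Nat.div_add_mod (u * r + v * (s + 1)) M
  have m1 := Nat.mod_lt (u * (r + 1) + v * s) hN
  have m2 := Nat.mod_lt (u * r + v * (s + 1)) hN
  set a := (u * (r + 1) + v * s) / M
  set b := (u * r + v * (s + 1)) / M
  set a' := (u * (r + 1) + v * s) % M
  set b' := (u * r + v * (s + 1)) % M
  rw [abs_le]
  zify at *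
  constructor
  · by_contra hc
    have : (M : ℤ) * (a + 2) ≤ M * b := mul_le_mul_of_nonneg_left (by omega) (by omega)
    nlinarith
  · by_contra hc
    have : (M : ℤ) * (b + 2) ≤ M * a := mul_le_mul_of_nonneg_left (by omega) (by omega)
    nlinarith

theorem pathPoint_step {n N s : ℕ} (hs : s < N) (j : Fin n) (x y : Box n N) :
    pathPoint s j x y = pathPoint s (j + 1) x y ∨
      Adj (pathPoint s j x y) (pathPoint s (j + 1) x y) := by
  have hne : ∀ i, i ≠ j → pathPoint s j x y i = pathPoint s (j + 1) x y i := by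
    intro i hi
    have hi' : (i : ℕ) ≠ j := fun h => hi (Fin.ext h)
    have : (i : ℕ) < j ↔ (i : ℕ) < j + 1 := by omega
    simp [pathPoint, linePoint, this]
  have hle : |((pathPoint s j x y j : ℕ) : ℤ) - (pathPoint s (j + 1) x y j : ℕ)| ≤ 1 := by
    have := div_line_succ (x j).isLt (y j).isLt hs
    rw [pathPoint, pathPoint, linePoint_val (by intro i; split_ifs <;> omega),
      linePoint_val (by intro i; split_ifs <;> omega)]
    simpa using this
  have hsum : ∑ i, |((pathPoint s j x y i : ℕ) : ℤ) - (pathPoint s (j + 1) x y i : ℕ)| =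
      |((pathPoint s j x y j : ℕ) : ℤ) - (pathPoint s (j + 1) x y j : ℕ)| := by
    refine Finset.sum_eq_single j (fun i _ hi => ?_) (by simp)
    rw [hne i hi]; simp
  rcases (abs_nonneg (((pathPoint s j x y j : ℕ) : ℤ) - (pathPoint s (j + 1) x y j : ℕ))).eq_or_lt
    with h | h
  · left
    funext i
    by_cases hi : i = j
    · subst hi
      rw [eq_comm, abs_eq_zero, sub_eq_zero] at h
      exact Fin.ext (by exact_mod_cast h)
    · exact hne i hi
  · right
    unfold Adj
    rw [hsum]
    omega

/-! ### Congestion of the paths and the comparison inequality -/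

theorem eq_of_line_div_eq {N a t v v' : ℕ} (ht : N ≤ 2 * t) (hN : 0 < N)
    (h : (a + v * t) / N = (a + v' * t) / N) (h2 : v % 2 = v' % 2) : v = v' := by
  by_contra hne
  wlog hlt : v < v' generalizing v v'
  · exact this h.symm h2.symm (Ne.symm hne) (by omega)
  -- Distinct values of equal parity differ by at least 2, which raises the numerator by 2t ≥ N and
  -- hence the quotient by at least 1.
  have h3 : (v + 2) * t ≤ v' * t := Nat.mul_le_mul_right _ (by omega)
  have h4 : (a + v * t + N) / N ≤ (a + v' * t) / N := Nat.div_le_div_right (by nlinarith)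
  rw [Nat.add_div_right _ hN] at h4
  omega

/-- At most `2N` pairs of endpoints in one dimension have a given point at a given time. -/
theorem card_line_fiber_le {N t : ℕ} (ht : t ≤ N) (w : ℕ) :
    (Finset.univ.filter fun p : Fin N × Fin N =>
      ((p.1 : ℕ) * (N - t) + (p.2 : ℕ) * t) / N = w).card ≤ 2 * N := by
  have hcard : (Finset.univ : Finset (Fin 2 × Fin N)).card = 2 * N := by simp
  rw [← hcard]
  -- The endpoint with the larger weight, t or N - t, is determined by its parity once the other
  -- endpoint is known. This leaves 2 · N possibilities.
  rcases le_total N (2 * t) with h | h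
  · refine Finset.card_le_card_of_injOn
      (fun p => (⟨(p.2 : ℕ) % 2, Nat.mod_lt _ (by norm_num)⟩, p.1)) (by simp) ?_
    rintro ⟨u, v⟩ hp ⟨u', v'⟩ hp' he
    simp only [Finset.coe_filter, Finset.mem_univ, true_and, Set.mem_ofPred_eq] at hp hp'
    simp only [Prod.mk.injEq, Fin.mk.injEq] at he
    obtain ⟨he, rfl⟩ := he
    have hN : 0 < N := by have := u.isLt; omega
    rw [← hp'] at hp
    have := eq_of_line_div_eq h hN hp he
    rw [Fin.ext this]
  · refine Finset.card_le_card_of_injOn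
      (fun p => (⟨(p.1 : ℕ) % 2, Nat.mod_lt _ (by norm_num)⟩, p.2)) (by simp) ?_
    rintro ⟨u, v⟩ hp ⟨u', v'⟩ hp' he
    simp only [Finset.coe_filter, Finset.mem_univ, true_and, Set.mem_ofPred_eq] at hp hp'
    simp only [Prod.mk.injEq, Fin.mk.injEq] at he
    obtain ⟨he, rfl⟩ := he
    have hN : 0 < N := by have := u.isLt; omega
    rw [← hp', add_comm, add_comm ((u' : ℕ) * _)] at hp
    have := eq_of_line_div_eq (t := N - t) (by omega) hN hp he
    rw [Fin.ext this]

theorem card_linePoint_fiber_le {n N : ℕ} {t : Fin n → ℕ} (ht : ∀ i, t i ≤ N) (a : Box n N) :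
    (Finset.univ.filter fun p : Box n N × Box n N => linePoint t p.1 p.2 = a).card
      ≤ (2 * N) ^ n := by
  calc _ ≤ (Fintype.piFinset fun i => Finset.univ.filter fun p : Fin N × Fin N =>
        ((p.1 : ℕ) * (N - t i) + (p.2 : ℕ) * t i) / N = a i).card := by
        refine Finset.card_le_card_of_injOn (fun p i => (p.1 i, p.2 i)) ?_ ?_
        · rintro ⟨x, y⟩ hp
          simp only [Finset.coe_filter, Finset.mem_univ, true_and, Set.mem_ofPred_eq] at hp
          simp only [Finset.mem_coe, Fintype.mem_piFinset, Finset.mem_filter, Finset.mem_univ,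
            true_and]
          intro i
          rw [← linePoint_val ht, hp]
        · rintro ⟨x, y⟩ _ ⟨x', y'⟩ _ he
          have h := fun i => Prod.mk.inj (congrFun he i)
          exact Prod.ext (funext fun i => (h i).1) (funext fun i => (h i).2)
    _ = ∏ i, _ := Fintype.card_piFinset _
    _ ≤ ∏ _i : Fin n, 2 * N := Finset.prod_le_prod' fun i _ => card_line_fiber_le (ht i) _
    _ = (2 * N) ^ n := by simp

theorem sum_linePoint_le {n N : ℕ} {t : Fin n → ℕ} (ht : ∀ i, t i ≤ N) {E : Box n N → ℝ}
    (hE : ∀ a, 0 ≤ E a) :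
    ∑ p : Box n N × Box n N, E (linePoint t p.1 p.2) ≤ (2 * (N : ℝ)) ^ n * ∑ a, E a := by
  rw [← Finset.sum_fiberwise (s := Finset.univ)
    (g := fun p : Box n N × Box n N => linePoint t p.1 p.2), Finset.mul_sum]
  refine Finset.sum_le_sum fun a _ => ?_
  rw [Finset.sum_congr rfl (g := fun _ => E a) fun p hp => by rw [(Finset.mem_filter.1 hp).2],
    Finset.sum_const, nsmul_eq_mul]
  refine mul_le_mul_of_nonneg_right ?_ (hE a)
  exact_mod_cast card_linePoint_fiber_le ht a

/-- Telescoping and Cauchy–Schwarz over the nN stages, trivial steps included. -/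
theorem sq_sub_le_path {n N : ℕ} (φ : Box n N → ℝ) (x y : Box n N) :
    (φ x - φ y) ^ 2 ≤ (n * N : ℝ) * ∑ s : Fin N, ∑ j : Fin n,
      (φ (pathPoint s j x y) - φ (pathPoint s (j + 1) x y)) ^ 2 := by
  have htel : φ x - φ y = ∑ s : Fin N, ∑ j : Fin n,
      (φ (pathPoint s j x y) - φ (pathPoint s (j + 1) x y)) := by
    have h1 : ∀ s : ℕ, ∑ j : Fin n, (φ (pathPoint s j x y) - φ (pathPoint s (j + 1) x y)) =
        φ (pathPoint s 0 x y) - φ (pathPoint (s + 1) 0 x y) := fun s => by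
      rw [Fin.sum_univ_eq_sum_range
        (fun j => φ (pathPoint s j x y) - φ (pathPoint s (j + 1) x y)),
        Finset.sum_range_sub' (fun j => φ (pathPoint s j x y)), pathPoint_last]
    simp only [h1]
    rw [Fin.sum_univ_eq_sum_range
        (fun s => φ (pathPoint s 0 x y) - φ (pathPoint (s + 1) 0 x y)),
      Finset.sum_range_sub' (fun s => φ (pathPoint s 0 x y)), pathPoint_end, pathPoint_zero_zero]
  rw [htel, ← Fintype.sum_prod_type', ← Fintype.sum_prod_type']
  refine sq_sum_le_card_mul_sum_sq.trans (le_of_eq ?_)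
  simp [mul_comm]

theorem edgeEnergy_nonneg {n N : ℕ} {F : Box n N → ℝ} (hF : ∀ k, 0 < F k) (φ : Box n N → ℝ)
    (k l : Box n N) : 0 ≤ edgeEnergy F φ k l := by
  unfold edgeEnergy
  split_ifs
  · exact mul_nonneg (le_min (hF k).le (hF l).le) (sq_nonneg _)
  · exact le_rfl

theorem sum_mul_sq_sub_le {n N : ℕ} {F : Box n N → ℝ} (hF : ∀ k, 0 < F k) {κ B : ℝ}
    (hB : ∀ k, F k ≤ B)
    (hpath : ∀ s < N, ∀ j ≤ n, ∀ x y, κ * min (F x) (F y) ≤ F (pathPoint s j x y))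
    (hκ : 0 < κ) (φ : Box n N → ℝ) :
    κ * ∑ x, ∑ y, F x * F y * (φ x - φ y) ^ 2 ≤
      B * (n * N) ^ 2 * (2 * N) ^ n * ∑ k, ∑ l, edgeEnergy F φ k l := by
  set E : Box n N → ℝ := fun k => ∑ l, edgeEnergy F φ k l with hE
  have hE0 : ∀ k, 0 ≤ E k := fun k => Finset.sum_nonneg fun l _ => edgeEnergy_nonneg hF φ k l
  have hterm : ∀ s : Fin N, ∀ j : Fin n, ∀ x y, κ * (F x * F y *
      (φ (pathPoint s j x y) - φ (pathPoint s (j + 1) x y)) ^ 2) ≤ B * E (pathPoint s j x y) := by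
    intro s j x y
    have hB0 : 0 ≤ B := (hF x).le.trans (hB x)
    rcases pathPoint_step s.isLt j x y with h | h
    · rw [← h]
      simpa using mul_nonneg hB0 (hE0 _)
    · set a := pathPoint s j x y
      set b := pathPoint s (j + 1) x y
      have hmin : κ * min (F x) (F y) ≤ min (F a) (F b) :=
        le_min (hpath s s.isLt j j.isLt.le x y) (hpath s s.isLt (j + 1) j.isLt x y)
      have h1 : edgeEnergy F φ a b ≤ E a :=
        Finset.single_le_sum (f := fun l => edgeEnergy F φ a l)
          (fun l _ => edgeEnergy_nonneg hF φ a l) (Finset.mem_univ b)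
      rw [edgeEnergy, if_pos h] at h1
      -- The max is paid for by B; the min is absorbed by the weight of the edge.
      calc _ = max (F x) (F y) * ((κ * min (F x) (F y)) * (φ a - φ b) ^ 2) := by
            rw [← max_mul_min (F x) (F y)]; ring
        _ ≤ B * (min (F a) (F b) * (φ a - φ b) ^ 2) := by
            refine mul_le_mul (max_le (hB x) (hB y))
              (mul_le_mul_of_nonneg_right hmin (sq_nonneg _)) ?_ hB0
            exact mul_nonneg (mul_nonneg hκ.le (le_min (hF x).le (hF y).le)) (sq_nonneg _)
        _ ≤ B * E a := mul_le_mul_of_nonneg_left h1 hB0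
  by_cases hne : Nonempty (Box n N)
  swap
  · rw [not_nonempty_iff] at hne
    simp
  have hB0 : 0 ≤ B := by
    obtain ⟨x⟩ := hne
    exact (hF x).le.trans (hB x)
  calc κ * ∑ x, ∑ y, F x * F y * (φ x - φ y) ^ 2
      ≤ ∑ p : Box n N × Box n N, (n * N : ℝ) * ∑ s : Fin N, ∑ j : Fin n,
          B * E (pathPoint s j p.1 p.2) := by
        rw [← Fintype.sum_prod_type', Finset.mul_sum]
        refine Finset.sum_le_sum fun p _ => ?_
        obtain ⟨x, y⟩ := p
        have h1 := mul_le_mul_of_nonneg_left (sq_sub_le_path φ x y)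
          (mul_nonneg hκ.le (mul_nonneg (hF x).le (hF y).le))
        calc κ * (F x * F y * (φ x - φ y) ^ 2) = κ * (F x * F y) * (φ x - φ y) ^ 2 := by ring
          _ ≤ _ := h1
          _ = (n * N : ℝ) * ∑ s : Fin N, ∑ j : Fin n, κ * (F x * F y *
              (φ (pathPoint s j x y) - φ (pathPoint s (j + 1) x y)) ^ 2) := by
            rw [mul_left_comm]
            simp only [Finset.mul_sum]
            refine Finset.sum_congr rfl fun s _ => Finset.sum_congr rfl fun j _ => by ring
          _ ≤ _ := by
            refine mul_le_mul_of_nonneg_left ?_ (by positivity)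
            exact Finset.sum_le_sum fun s _ => Finset.sum_le_sum fun j _ => hterm s j x y
    _ = (n * N : ℝ) * ∑ s : Fin N, ∑ j : Fin n,
          B * ∑ p : Box n N × Box n N, E (pathPoint s j p.1 p.2) := by
        rw [← Finset.mul_sum, Finset.sum_comm]
        congr 1
        refine Finset.sum_congr rfl fun s _ => ?_
        rw [Finset.sum_comm]
        exact Finset.sum_congr rfl fun j _ => by rw [Finset.mul_sum]
    _ ≤ (n * N : ℝ) * ∑ _s : Fin N, ∑ _j : Fin n, B * ((2 * (N : ℝ)) ^ n * ∑ a, E a) := by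
        refine mul_le_mul_of_nonneg_left ?_ (by positivity)
        refine Finset.sum_le_sum fun s _ => Finset.sum_le_sum fun j _ => ?_
        refine mul_le_mul_of_nonneg_left (sum_linePoint_le ?_ hE0) hB0
        intro i
        have := s.isLt
        split_ifs <;> omega
    _ = _ := by
        simp only [Finset.sum_const, Finset.card_univ, Fintype.card_fin, nsmul_eq_mul]
        ring

/-- A weight bounded below along lattice paths, and with supremum comparable to its mean, has
Metropolis gap of order `N⁻²`. -/
theorem le_spectralGap_metropolis {n N : ℕ} (hn : 0 < n) (hN : 2 ≤ N) {F : Box n N → ℝ}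
    (hF : ∀ k, 0 < F k) {κ B C : ℝ} (hκ : 0 < κ) (hC : 0 < C) (hB : ∀ k, F k ≤ B)
    (hBC : B * (N : ℝ) ^ n ≤ C * ∑ k, F k)
    (hpath : ∀ s < N, ∀ j ≤ n, ∀ x y, κ * min (F x) (F y) ≤ F (pathPoint s j x y)) :
    κ / (2 ^ (n + 1) * C * n ^ 3) / (N : ℝ) ^ 2 ≤ spectralGap (metropolis F) := by
  have hnR : (0 : ℝ) < n := by exact_mod_cast hn
  have hNR : (0 : ℝ) < N := by exact_mod_cast (by omega : 0 < N)
  refine le_spectralGap_of_poincare _ F hF (metropolis_reversible hF) ?_ _ ?_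
  · simp only [Fintype.card_pi, Fintype.card_fin, Finset.prod_const, Finset.card_univ]
    exact Nat.one_lt_pow hn.ne' (by omega)
  intro φ hφ
  refine le_trans ?_ (edgeEnergy_le_dirichlet hn hF φ)
  have h1 := sum_mul_sq_sub_le hF hB hpath hκ φ
  set Z := ∑ k, F k with hZ
  set V := ∑ k, F k * φ k ^ 2 with hV
  set D := ∑ k, ∑ l, edgeEnergy F φ k l with hD
  have hD0 : 0 ≤ D := Finset.sum_nonneg fun k _ => Finset.sum_nonneg fun l _ =>
    edgeEnergy_nonneg hF φ k l
  -- Expanding the square, the cross term is the squared mean, which vanishes.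
  have hvar : ∑ x, ∑ y, F x * F y * (φ x - φ y) ^ 2 = 2 * Z * V := by
    have : ∑ x, ∑ y, F x * F y * (φ x - φ y) ^ 2 =
        V * Z + Z * V - 2 * ((∑ x, F x * φ x) * ∑ y, F y * φ y) := by
      rw [hV, hZ]
      simp only [Finset.sum_mul_sum]
      simp only [Finset.mul_sum, ← Finset.sum_add_distrib, ← Finset.sum_sub_distrib]
      exact Finset.sum_congr rfl fun i _ => Finset.sum_congr rfl fun j _ => by ring
    rw [this, hφ]; ring
  rw [hvar] at h1
  have hZ0 : 0 < Z := by
    have : Nonempty (Box n N) := ⟨fun _ => ⟨0, by omega⟩⟩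
    exact Finset.sum_pos (fun k _ => hF k) Finset.univ_nonempty
  have h2 : B * (n * N : ℝ) ^ 2 * (2 * N) ^ n * D ≤ C * Z * ((n * N) ^ 2 * 2 ^ n * D) := by
    calc B * (n * N : ℝ) ^ 2 * (2 * N) ^ n * D = B * (N : ℝ) ^ n * ((n * N) ^ 2 * 2 ^ n * D) := by
          rw [mul_pow 2]; ring
      _ ≤ _ := mul_le_mul_of_nonneg_right hBC (by positivity)
  have h3 : 2 * κ * V ≤ C * ((n * N) ^ 2 * 2 ^ n * D) := by
    refine le_of_mul_le_mul_left ?_ hZ0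
    linarith
  rw [div_div, div_mul_eq_mul_div, div_le_iff₀ (by positivity)]
  rw [pow_succ 2 n]
  have : 1 / (4 * (n : ℝ)) * D * (2 ^ n * 2 * C * n ^ 3 * N ^ 2) =
      1 / 2 * (C * ((n * N) ^ 2 * 2 ^ n * D)) := by
    field_simp
    ring
  rw [this]
  linarith

/-! ### Functions of the flat class on the grid -/

open MeasureTheory

/-- In the sup norm the derivative of log f has norm at most nA, by summing the n partial
derivatives. The mean value inequality on the convex cube then applies. -/
theorem FlatClass.le_exp_mul {n : ℕ} {ε η A : ℝ} {f : (Fin n → ℝ) → ℝ}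
    (hf : FlatClass n ε η A f) (hA : 0 ≤ A) {x y : Fin n → ℝ} (hx : x ∈ unitCube n)
    (hy : y ∈ unitCube n) : f x ≤ Real.exp (n * A * ‖x - y‖) * f y := by
  have hdiff : DifferentiableOn ℝ (fun y => Real.log (f y)) (unitCube n) := fun z hz =>
    ((hf.contDiffOn.differentiableOn one_ne_zero) z hz).log (hf.pos z hz).ne'
  have hbound : ∀ z ∈ unitCube n,
      ‖fderivWithin ℝ (fun y => Real.log (f y)) (unitCube n) z‖ ≤ n * A := by
    intro z hz
    refine ContinuousLinearMap.opNorm_le_bound _ (by positivity) fun v => ?_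
    set L := fderivWithin ℝ (fun y => Real.log (f y)) (unitCube n) z
    have hv : L v = ∑ i, v i * L (Pi.single i 1) := by
      conv_lhs => rw [pi_eq_sum_univ' v, map_sum]
      exact Finset.sum_congr rfl fun i _ => by rw [map_smul, smul_eq_mul]
    rw [hv]
    refine (norm_sum_le _ _).trans ?_
    calc ∑ i, ‖v i * L (Pi.single i 1)‖ ≤ ∑ _i : Fin n, ‖v‖ * A := by
          refine Finset.sum_le_sum fun i _ => ?_
          rw [norm_mul]
          exact mul_le_mul (norm_le_pi_norm v i) (hf.partial_log_le z hz i) (norm_nonneg _)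
            (norm_nonneg _)
      _ = n * A * ‖v‖ := by simp; ring
  have h := (convex_Icc (0 : Fin n → ℝ) 1).norm_image_sub_le_of_norm_fderivWithin_le
    hdiff hbound hy hx
  have h' := (le_abs_self _).trans h
  rw [← Real.log_le_log_iff (hf.pos x hx) (mul_pos (Real.exp_pos _) (hf.pos y hy)),
    Real.log_mul (Real.exp_pos _).ne' (hf.pos y hy).ne', Real.log_exp]
  linarith

/-- The centre of a grid cell. -/
noncomputable def gridPoint {n : ℕ} (N : ℕ) (k : Box n N) : Fin n → ℝ :=
  fun i => ((((k i : ℕ) + 1 : ℕ) : ℝ) - 1 / 2) / N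

theorem gridPoint_mem {n N : ℕ} (k : Box n N) : gridPoint N k ∈ unitCube n := by
  have h : ∀ i, 0 ≤ gridPoint N k i ∧ gridPoint N k i ≤ 1 := fun i => by
    have h1 : ((k i : ℕ) : ℝ) + 1 ≤ N := by exact_mod_cast (k i).isLt
    have h2 : (0 : ℝ) ≤ ((k i : ℕ) : ℝ) := Nat.cast_nonneg _
    have hN : (0 : ℝ) < N := by linarith
    simp only [gridPoint]
    push_cast
    exact ⟨div_nonneg (by linarith) hN.le, (div_le_one hN).2 (by linarith)⟩
  exact ⟨fun i => (h i).1, fun i => (h i).2⟩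

theorem FlatClass.le_exp_mul_of_close {n N : ℕ} {ε η A : ℝ} {f : (Fin n → ℝ) → ℝ}
    (hf : FlatClass n ε η A f) (hA : 0 ≤ A) (hAN : A ≤ N) (hN : 0 < N) {x y : Fin n → ℝ}
    (hx : x ∈ unitCube n) (hy : y ∈ unitCube n) {r : ℝ} (hr : 0 ≤ r)
    (hxy : ∀ i, |x i - y i| ≤ r / N) : f x ≤ Real.exp (n * r) * f y := by
  refine (hf.le_exp_mul hA hx hy).trans
    (mul_le_mul_of_nonneg_right (Real.exp_le_exp.2 ?_) (hf.pos y hy).le)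
  have hNR : (0 : ℝ) < N := by exact_mod_cast hN
  have h1 : ‖x - y‖ ≤ r / N := (pi_norm_le_iff_of_nonneg (by positivity)).2 hxy
  calc n * A * ‖x - y‖ ≤ n * N * (r / N) := by gcongr
    _ = n * r := by field_simp

/-- Taking the floor costs less than 1, and being one time step ahead costs |v - u|/N < 1. The
comparison is at the common time s so that the unrounded point lies on the true segment, whichever
coordinates have already advanced. -/
theorem abs_line_sub_div_le {N u v s t : ℕ} (hu : u < N) (hv : v < N) (hs : s < N)
    (ht : t = s ∨ t = s + 1) :
    |(u + (s / N : ℝ) * ((v : ℝ) - u)) - ((u * (N - t) + v * t) / N : ℕ)| ≤ 2 := by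
  have hN : 0 < N := by omega
  have hNR : (0 : ℝ) < N := by exact_mod_cast hN
  have htN : t ≤ N := by omega
  have e := Nat.div_add_mod (u * (N - t) + v * t) N
  have m := Nat.mod_lt (u * (N - t) + v * t) hN
  set q := (u * (N - t) + v * t) / N
  set r := (u * (N - t) + v * t) % N
  have e' : (N : ℝ) * q + r = u * (N - t) + v * t := by
    rw [← Nat.cast_sub htN]; exact_mod_cast e
  have m' : (r : ℝ) < N := by exact_mod_cast m
  have r0 : (0 : ℝ) ≤ r := Nat.cast_nonneg _
  have hu' : (u : ℝ) < N := by exact_mod_cast hu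
  have hv' : (v : ℝ) < N := by exact_mod_cast hv
  have hu0 : (0 : ℝ) ≤ u := Nat.cast_nonneg _
  have hv0 : (0 : ℝ) ≤ v := Nat.cast_nonneg _
  have key : (u + (s / N : ℝ) * ((v : ℝ) - u)) - q = (r - ((t : ℝ) - s) * (v - u)) / N := by
    field_simp
    linear_combination -e'
  rw [key, abs_div, abs_of_pos hNR, div_le_iff₀ hNR, abs_le]
  rcases ht with rfl | rfl
  · constructor <;> linarith
  · push_cast
    constructor <;> linarith

theorem FlatClass.le_pathPoint {n N : ℕ} {ε η A : ℝ} {f : (Fin n → ℝ) → ℝ}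
    (hf : FlatClass n ε η A f) (hA : 0 ≤ A) (hAN : A ≤ N) {s : ℕ} (hs : s < N)
    (j : ℕ) (x y : Box n N) :
    Real.exp (-(n * 2)) * ε * min (discretize N f x) (discretize N f y) ≤
      discretize N f (pathPoint s j x y) := by
  have hN : 0 < N := by omega
  have hNR : (0 : ℝ) < N := by exact_mod_cast hN
  have hsR : (s : ℝ) ≤ N := by exact_mod_cast hs.le
  set t : ℝ := s / N with ht
  have ht01 : t ∈ Set.Icc (0 : ℝ) 1 := ⟨by positivity, (div_le_one hNR).2 hsR⟩
  set z := gridPoint N x + t • (gridPoint N y - gridPoint N x) with hz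
  have hzm : z ∈ unitCube n :=
    (convex_Icc (0 : Fin n → ℝ) 1).add_smul_sub_mem (gridPoint_mem x) (gridPoint_mem y) ht01
  have h1 : ε * min (discretize N f x) (discretize N f y) ≤ f z :=
    hf.segment _ (gridPoint_mem x) _ (gridPoint_mem y) t ht01
  have h2 : f z ≤ Real.exp (n * 2) * discretize N f (pathPoint s j x y) := by
    refine hf.le_exp_mul_of_close hA hAN hN hzm (gridPoint_mem _) (by norm_num) fun i => ?_
    have h3 := abs_line_sub_div_le (x i).isLt (y i).isLt hs
      (t := if (i : ℕ) < j then s + 1 else s) (by split_ifs <;> simp)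
    rw [← linePoint_val (t := fun i : Fin n => if (i : ℕ) < j then s + 1 else s)
      (fun i => by split_ifs <;> omega) x y i] at h3
    have h4 : z i - gridPoint N (pathPoint s j x y) i =
        (((x i : ℕ) + (s / N : ℝ) * (((y i : ℕ) : ℝ) - (x i : ℕ))) -
          (pathPoint s j x y i : ℕ)) / N := by
      simp only [hz, ht, Pi.add_apply, Pi.smul_apply, Pi.sub_apply, smul_eq_mul, gridPoint]
      push_cast
      field_simp
      ring
    rw [h4, abs_div, abs_of_pos hNR]
    exact div_le_div_of_nonneg_right h3 hNR.le
  rw [Real.exp_neg, mul_assoc, inv_mul_le_iff₀ (Real.exp_pos _)]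
  exact h1.trans h2

theorem exists_cell {N : ℕ} (hN : 0 < N) {x : ℝ} (h0 : 0 ≤ x) (h1 : x ≤ 1) :
    ∃ k : Fin N, (k : ℕ) / (N : ℝ) ≤ x ∧ x ≤ ((k : ℕ) + 1) / (N : ℝ) := by
  have hNR : (0 : ℝ) < N := by exact_mod_cast hN
  rcases h1.eq_or_lt with rfl | h
  -- The right end x = 1 belongs to the last closed cell; the floor would give N.
  · refine ⟨⟨N - 1, by omega⟩, ?_, ?_⟩
    · rw [div_le_one hNR]; exact_mod_cast Nat.sub_le N 1
    · rw [one_le_div hNR]; exact_mod_cast (by simp; omega)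
  · have hx : 0 ≤ x * N := by positivity
    refine ⟨⟨⌊x * N⌋₊, (Nat.floor_lt hx).2 (by nlinarith)⟩, ?_, ?_⟩
    · rw [div_le_iff₀ hNR]; exact Nat.floor_le hx
    · rw [le_div_iff₀ hNR]; exact (Nat.lt_floor_add_one _).le

/-- On each cell f is at most eⁿ times its value at the centre, and a cell has volume N⁻ⁿ. The
closed cells overlap on their faces, which is harmless for an upper bound by a sum of nonnegative
indicators. -/
theorem FlatClass.integral_le_sum {n N : ℕ} {ε η A : ℝ} {f : (Fin n → ℝ) → ℝ}
    (hf : FlatClass n ε η A f) (hA : 0 ≤ A) (hAN : A ≤ N) (hN : 0 < N) :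
    (∫ x in unitCube n, f x) * (N : ℝ) ^ n ≤ Real.exp n * ∑ k, discretize N f k := by
  have hNR : (0 : ℝ) < N := by exact_mod_cast hN
  let cell : Box n N → Set (Fin n → ℝ) := fun k =>
    Set.Icc (fun i => ((k i : ℕ) : ℝ) / N) (fun i => (((k i : ℕ) : ℝ) + 1) / N)
  have hcell : ∀ k, MeasurableSet (cell k) := fun k => measurableSet_Icc
  have hvol : ∀ k, volume.real (cell k) = ((N : ℝ) ^ n)⁻¹ := fun k => by
    have : ∀ i : Fin n, (((k i : ℕ) : ℝ) + 1) / N - ((k i : ℕ) : ℝ) / N = (N : ℝ)⁻¹ := fun i => by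
      field_simp; ring
    rw [Measure.real, Real.volume_Icc_pi_toReal]
    · simp [this]
    · intro i
      have := this i
      have h := inv_pos.2 hNR
      linarith
  have hF : ∀ k, 0 < discretize N f k := fun k => hf.pos _ (gridPoint_mem k)
  set g : (Fin n → ℝ) → ℝ := fun x => ∑ k : Box n N,
    (cell k).indicator (fun _ => Real.exp n * discretize N f k) x with hg
  have hint : ∀ k : Box n N, IntegrableOn
      ((cell k).indicator (fun _ => Real.exp n * discretize N f k)) (unitCube n) := fun k =>
    (integrable_const_iff.2 (Or.inr ⟨by
      rw [Measure.restrict_apply_univ]; exact isCompact_Icc.measure_lt_top⟩)).indicator (hcell k)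
  have hle : ∫ x in unitCube n, f x ≤ ∫ x in unitCube n, g x := by
    refine setIntegral_mono_on (hf.contDiffOn.continuousOn.integrableOn_compact isCompact_Icc)
      (integrable_finsetSum _ fun k _ => hint k) measurableSet_Icc fun x hx => ?_
    choose k hk using fun i => exists_cell hN (hx.1 i) (hx.2 i)
    have hxk : x ∈ cell k := ⟨fun i => (hk i).1, fun i => (hk i).2⟩
    have h1 : f x ≤ Real.exp (n * 1) * discretize N f k := by
      refine hf.le_exp_mul_of_close hA hAN hN hx (gridPoint_mem k) zero_le_one fun i => ?_
      obtain ⟨ha, hb⟩ := hk i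
      rw [div_le_iff₀ hNR] at ha
      rw [le_div_iff₀ hNR] at hb
      have h2 : x i - gridPoint N k i = (x i * N - ((k i : ℕ) + 1 / 2)) / N := by
        simp only [gridPoint]; push_cast; field_simp; ring
      rw [h2, abs_div, abs_of_pos hNR]
      refine div_le_div_of_nonneg_right (abs_le.2 ⟨?_, ?_⟩) hNR.le <;> linarith
    rw [mul_one] at h1
    have h3 := Finset.single_le_sum (f := fun k : Box n N =>
      (cell k).indicator (fun _ => Real.exp n * discretize N f k) x)
      (fun k _ => Set.indicator_nonneg (fun _ _ => mul_nonneg (Real.exp_pos _).le (hF k).le) x)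
      (Finset.mem_univ k)
    simp only [Set.indicator_of_mem hxk] at h3
    exact h1.trans h3
  have hsum : ∫ x in unitCube n, g x ≤
      ∑ k, ((N : ℝ) ^ n)⁻¹ * (Real.exp n * discretize N f k) := by
    rw [hg, integral_finsetSum _ fun k _ => hint k]
    refine Finset.sum_le_sum fun k _ => ?_
    rw [setIntegral_indicator (hcell k), setIntegral_const, smul_eq_mul, ← hvol k]
    refine mul_le_mul_of_nonneg_right ?_ (mul_nonneg (Real.exp_pos _).le (hF k).le)
    exact measureReal_mono Set.inter_subset_right isCompact_Icc.measure_lt_top.ne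
  have h := hle.trans hsum
  rw [← Finset.mul_sum, ← Finset.mul_sum, ← div_eq_inv_mul, le_div_iff₀ (by positivity)] at h
  exact h

end MetropolisFlat

theorem mainTheorem2 (n : ℕ) (hn : 2 ≤ n) (ε η : ℝ) (hε : 0 < ε) (hη : 0 < η) :
    ∃ c : ℝ, 0 < c ∧
      ∀ (A : ℝ) (N : ℕ), 1 ≤ A → A ≤ (N : ℝ) → 2 ≤ N →
        ∀ f : (Fin n → ℝ) → ℝ, MetropolisFlat.FlatClass n ε η A f →
          c / (N : ℝ) ^ 2 ≤
            MetropolisFlat.spectralGap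
              (MetropolisFlat.metropolis (MetropolisFlat.discretize N f)) := by
  have hn0 : 0 < n := by omega
  -- Here κ = e⁻²ⁿ ε comes from `FlatClass.le_pathPoint`, and C = eⁿ/η from combining the condition
  -- with η and `FlatClass.integral_le_sum`.
  refine ⟨Real.exp (-(n * 2)) * ε / (2 ^ (n + 1) * (Real.exp n / η) * n ^ 3), by positivity, ?_⟩
  intro A N hA hAN hN f hf
  have hA0 : 0 ≤ A := by linarith
  refine MetropolisFlat.le_spectralGap_metropolis hn0 hN
    (B := sSup ((fun x => |f x|) '' MetropolisFlat.unitCube n))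
    (fun k => hf.pos _ (MetropolisFlat.gridPoint_mem k)) (by positivity) (by positivity) ?_ ?_
    (fun s hs j _ x y => hf.le_pathPoint hA0 hAN hs j x y)
  · intro k
    have hbdd : BddAbove ((fun x => |f x|) '' MetropolisFlat.unitCube n) :=
      (isCompact_Icc.image_of_continuousOn hf.contDiffOn.continuousOn.abs).bddAbove
    exact (le_abs_self _).trans
      (le_csSup hbdd (Set.mem_image_of_mem _ (MetropolisFlat.gridPoint_mem k)))
  · have h1 := mul_le_mul_of_nonneg_right hf.sup_le_integral
      (by positivity : (0 : ℝ) ≤ (N : ℝ) ^ n)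
    have h2 := h1.trans (hf.integral_le_sum hA0 hAN (by omega))
    rw [div_mul_eq_mul_div, le_div_iff₀ hη, mul_right_comm, mul_comm _ η]
    exact h2
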